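/- Let $N$ be a connected 2-step nilpotent Lie group (that is, $N$ is nilpotent of class exactly $2$; in particular $N$ is not abelian), let $\mathfrak n$ be its Lie algebra, $\mathfrak z$ the center of $\mathfrak n$, and let $\langle\cdot,\cdot\rangle$ be a bi-invariant pseudo-Riemannian metric on $N$ (a smooth pseudo-Riemannian metric for which all left and all right translations are isometries). Let $\mathrm{Iso}(N)$ be the group of all isometries of $N$ (diffeomorphisms preserving the metric), and let $\mathrm{Iso}^{aut}(N)=\{L_a\circ\varphi : a\in N,\ \varphi \text{ an isometric automorphism of } N\}$, where $L_a$ is left translation by $a$. For a direct sum decomposition of vector spaces $\mathfrak n=\mathfrak v\oplus\mathfrak z$, let $TN=\mathfrak vN\oplus\mathfrak zN$ be the splitting obtained by left translation, and let $\mathrm{Iso}^{spl}(N)$ be the group of isometries $f$ with $df_x(\mathfrak vN_x)=\mathfrak vN_{f(x)}$ and $df_x(\mathfrak zN_x)=\mathfrak zN_{f(x)}$ for all $x\in N$. Then: 1. the center is degenerate: there is a nonzero $z\in\mathfrak z$ with $\langle z,w\rangle=0$ for all $w\in\mathfrak z$; 2. for every decomposition $\mathfrak n=\mathfrak v\oplus\mathfrak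 z$ one has $\mathrm{Iso}^{spl}(N)\neq\mathrm{Iso}^{aut}(N)$ and $\mathrm{Iso}^{spl}(N)\subsetneq\mathrm{Iso}(N)$; moreover, for every $n\in N$ the conjugation $\chi_n(g)=ngn^{-1}$ belongs to $\mathrm{Iso}^{aut}(N)$, and if $n$ is not in the center of $N$, then $\chi_n\notin\mathrm{Iso}^{spl}(N)$; 3. $\mathrm{Iso}^{aut}(N)\subsetneq\mathrm{Iso}(N)$; moreover, the inversion $g\mapsto g^{-1}$ belongs to $\mathrm{Iso}(N)$ but not to $\mathrm{Iso}^{aut}(N)$. -/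

import Mathlib

open scoped Manifold ContDiff

noncomputable section

/-- A smooth pseudo-Riemannian metric on a smooth manifold modelled on a finite-dimensional `E`:
a smooth section of nondegenerate symmetric bilinear forms on the tangent spaces. -/
structure PseudoRiemannianMetric (E : Type*) [NormedAddCommGroup E] [NormedSpace ℝ E]
    (M : Type*) [TopologicalSpace M] [ChartedSpace E M] [IsManifold 𝓘(ℝ, E) ∞ M] where
  /-- The bilinear form on each tangent space. -/
  inner (x : M) : TangentSpace 𝓘(ℝ, E) x →L[ℝ] TangentSpace 𝓘(ℝ, E) x →L[ℝ] ℝ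
  symm (x : M) (u v : TangentSpace 𝓘(ℝ, E) x) : inner x u v = inner x v u
  nondegenerate (x : M) (u : TangentSpace 𝓘(ℝ, E) x) : (∀ v, inner x u v = 0) → u = 0
  contMDiff : ContMDiff 𝓘(ℝ, E) (𝓘(ℝ, E).prod 𝓘(ℝ, E →L[ℝ] E →L[ℝ] ℝ)) ∞
    (fun x ↦ Bundle.TotalSpace.mk' (E →L[ℝ] E →L[ℝ] ℝ)
      (E := fun x : M ↦ TangentSpace 𝓘(ℝ, E) x →L[ℝ] TangentSpace 𝓘(ℝ, E) x →L[ℝ] ℝ)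
      x (inner x))

namespace PseudoRiemannianMetric

section Manifold

variable {E : Type*} [NormedAddCommGroup E] [NormedSpace ℝ E]
  {M : Type*} [TopologicalSpace M] [ChartedSpace E M] [IsManifold 𝓘(ℝ, E) ∞ M]

/-- The map `f : M → M` pulls the metric back to itself. -/
def IsPreservedBy (m : PseudoRiemannianMetric E M) (f : M → M) : Prop :=
  ∀ (x : M) (u v : TangentSpace 𝓘(ℝ, E) x),
    m.inner (f x) (mfderiv 𝓘(ℝ, E) 𝓘(ℝ, E) f x u) (mfderiv 𝓘(ℝ, E) 𝓘(ℝ, E) f x v)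
      = m.inner x u v

/-- For a bijection `f` whose inverse is smooth, `d(f⁻¹) ∘ df = id`. -/
theorem mfderiv_symm_apply_mfderiv {f : Equiv.Perm M} (hf : ContMDiff 𝓘(ℝ, E) 𝓘(ℝ, E) ∞ f)
    (hf' : ContMDiff 𝓘(ℝ, E) 𝓘(ℝ, E) ∞ f.symm) (x : M) (u : TangentSpace 𝓘(ℝ, E) x) :
    mfderiv 𝓘(ℝ, E) 𝓘(ℝ, E) f.symm (f x) (mfderiv 𝓘(ℝ, E) 𝓘(ℝ, E) f x u) = u := by
  have h := mfderiv_comp_apply (I' := 𝓘(ℝ, E)) x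
    (hf'.mdifferentiable (by simp) (f x)) (hf.mdifferentiable (by simp) x) u
  have e : (f.symm ∘ f : M → M) = id := by ext y; simp
  rw [e, mfderiv_id] at h
  exact h.symm

/-- The full isometry group: diffeomorphisms of `M` preserving the metric. -/
def Iso (m : PseudoRiemannianMetric E M) : Subgroup (Equiv.Perm M) where
  carrier := {f | ContMDiff 𝓘(ℝ, E) 𝓘(ℝ, E) ∞ f ∧ ContMDiff 𝓘(ℝ, E) 𝓘(ℝ, E) ∞ f.symm ∧
    m.IsPreservedBy f}
  one_mem' := by
    refine ⟨contMDiff_id, contMDiff_id, fun x u v ↦ ?_⟩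
    have e : ((1 : Equiv.Perm M) : M → M) = id := rfl
    rw [e, mfderiv_id]
    rfl
  mul_mem' := by
    rintro f g ⟨hf, hf', hfm⟩ ⟨hg, hg', hgm⟩
    refine ⟨hf.comp hg, hg'.comp hf', fun x u v ↦ ?_⟩
    have e : ((f * g : Equiv.Perm M) : M → M) = f ∘ g := rfl
    have d := fun w ↦ mfderiv_comp_apply (I' := 𝓘(ℝ, E)) x
      (hf.mdifferentiable (by simp) (g x)) (hg.mdifferentiable (by simp) x) w
    rw [e, d u, d v]
    exact (hfm (g x) _ _).trans (hgm x u v)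
  inv_mem' := by
    rintro f ⟨hf, hf', hfm⟩
    refine ⟨hf', hf, fun x u v ↦ ?_⟩
    have e : ((f⁻¹ : Equiv.Perm M) : M → M) = f.symm := rfl
    rw [e]
    have h := hfm (f.symm x) (mfderiv 𝓘(ℝ, E) 𝓘(ℝ, E) f.symm x u)
      (mfderiv 𝓘(ℝ, E) 𝓘(ℝ, E) f.symm x v)
    have d := mfderiv_symm_apply_mfderiv (f := f.symm) hf' hf x
    simp only [Equiv.symm_symm] at d
    rw [← h, d u, d v, f.apply_symm_apply]

/-- A family `D` of subspaces of the tangent spaces is preserved by `f`: `df_x (D_x) = D_{f x}`. -/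
def PreservesDistribution (f : M → M) (D : ∀ x : M, Submodule ℝ (TangentSpace 𝓘(ℝ, E) x)) : Prop :=
  ∀ x : M, (D x).map (mfderiv 𝓘(ℝ, E) 𝓘(ℝ, E) f x).toLinearMap = D (f x)

/-- The isometries preserving both of two given distributions. -/
def IsoPreserving (m : PseudoRiemannianMetric E M)
    (D D' : ∀ x : M, Submodule ℝ (TangentSpace 𝓘(ℝ, E) x)) : Subgroup (Equiv.Perm M) where
  carrier := {f | f ∈ m.Iso ∧ PreservesDistribution f D ∧ PreservesDistribution f D'}
  one_mem' := by
    have e : ((1 : Equiv.Perm M) : M → M) = id := rfl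
    have key (D : ∀ x : M, Submodule ℝ (TangentSpace 𝓘(ℝ, E) x)) :
        PreservesDistribution (1 : Equiv.Perm M) D := fun x ↦ by
      rw [e, mfderiv_id]
      exact Submodule.map_id _
    exact ⟨m.Iso.one_mem, key D, key D'⟩
  mul_mem' := by
    rintro f g ⟨hf, hfD, hfD'⟩ ⟨hg, hgD, hgD'⟩
    have e : ((f * g : Equiv.Perm M) : M → M) = f ∘ g := rfl
    have key (D : ∀ x : M, Submodule ℝ (TangentSpace 𝓘(ℝ, E) x))
        (h : PreservesDistribution f D) (h' : PreservesDistribution g D) :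
        PreservesDistribution (f * g : Equiv.Perm M) D := fun x ↦ by
      rw [e, mfderiv_comp (I' := 𝓘(ℝ, E)) x (hf.1.mdifferentiable (by simp) (g x))
        (hg.1.mdifferentiable (by simp) x)]
      refine (Submodule.map_comp _ _ _).trans ?_
      rw [h' x]
      exact h (g x)
    exact ⟨m.Iso.mul_mem hf hg, key D hfD hgD, key D' hfD' hgD'⟩
  inv_mem' := by
    rintro f ⟨hf, hfD, hfD'⟩
    have key (D : ∀ x : M, Submodule ℝ (TangentSpace 𝓘(ℝ, E) x))
        (h : PreservesDistribution f D) :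
        PreservesDistribution (f⁻¹ : Equiv.Perm M) D := fun x ↦ by
      obtain ⟨y, rfl⟩ := f.surjective x
      have e : (f⁻¹ : Equiv.Perm M) (f y) = y := f.symm_apply_apply y
      have d := mfderiv_symm_apply_mfderiv (f := f) hf.1 hf.2.1 y
      rw [e, ← h y]
      ext w
      simp only [Submodule.mem_map]
      constructor
      · rintro ⟨_, ⟨u, hu, rfl⟩, rfl⟩
        exact (d u).symm ▸ hu
      · intro hw
        exact ⟨_, ⟨w, hw, rfl⟩, d w⟩
    exact ⟨m.Iso.inv_mem hf, key D hfD, key D' hfD'⟩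

end Manifold

section LieGroup

variable {E : Type*} [NormedAddCommGroup E] [NormedSpace ℝ E]
  {N : Type*} [TopologicalSpace N] [ChartedSpace E N] [Group N] [LieGroup 𝓘(ℝ, E) ∞ N]

/-- The metric is bi-invariant: all left and all right translations preserve it. -/
def IsBiInvariant (m : PseudoRiemannianMetric E N) : Prop :=
  (∀ a : N, m.IsPreservedBy (fun x ↦ a * x)) ∧ ∀ a : N, m.IsPreservedBy (fun x ↦ x * a)

/-- The distribution on `N` obtained by left-translating a subspace of the Lie algebra. -/
def leftTranslate (V : Submodule ℝ (GroupLieAlgebra 𝓘(ℝ, E) N)) (x : N) :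
    Submodule ℝ (TangentSpace 𝓘(ℝ, E) x) :=
  V.map (show TangentSpace 𝓘(ℝ, E) (1 : N) →ₗ[ℝ] TangentSpace 𝓘(ℝ, E) x from
    (mfderiv 𝓘(ℝ, E) 𝓘(ℝ, E) (fun y ↦ x * y) (1 : N)).toLinearMap)

/-- The group `N · H` with `H` the group of isometric automorphisms of `N`: all maps
`L_a ∘ φ` with `a ∈ N` and `φ` a group automorphism that is an isometry. -/
def IsoAut (m : PseudoRiemannianMetric E N) : Subgroup (Equiv.Perm N) where
  carrier := {f | ∃ (a : N) (φ : N ≃* N), φ.toEquiv ∈ m.Iso ∧ f = Equiv.mulLeft a * φ.toEquiv}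
  one_mem' := ⟨1, MulEquiv.refl N, m.Iso.one_mem, by ext; simp⟩
  mul_mem' := by
    rintro _ _ ⟨a, φ, hφ, rfl⟩ ⟨b, ψ, hψ, rfl⟩
    exact ⟨a * φ b, ψ.trans φ, m.Iso.mul_mem hφ hψ, by ext; simp [mul_assoc]⟩
  inv_mem' := by
    rintro _ ⟨a, φ, hφ, rfl⟩
    refine ⟨φ.symm a⁻¹, φ.symm, m.Iso.inv_mem hφ, ?_⟩
    rw [inv_eq_iff_mul_eq_one]
    ext
    simp

/-- A smooth Lie group has the regularity that Mathlib needs for its Lie algebra. -/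
theorem lieGroup_minSmoothness : LieGroup 𝓘(ℝ, E) (minSmoothness ℝ 3) N :=
  LieGroup.of_le (n := ∞) (by
    rw [minSmoothness_of_isRCLikeNormedField]
    exact WithTop.coe_le_coe.2 le_top)

variable [FiniteDimensional ℝ E]

variable (E N) in
/-- The center of the Lie algebra of `N`, as a subspace. -/
def lieCenter : Submodule ℝ (GroupLieAlgebra 𝓘(ℝ, E) N) :=
  haveI : CompleteSpace E := FiniteDimensional.complete ℝ E
  haveI : LieGroup 𝓘(ℝ, E) (minSmoothness ℝ 3) N := lieGroup_minSmoothness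
  (LieAlgebra.center ℝ (GroupLieAlgebra 𝓘(ℝ, E) N)).toSubmodule

/-- The bracket on the right is the bracket of left-invariant vector fields at the identity. -/
theorem mem_lieCenter {z : GroupLieAlgebra 𝓘(ℝ, E) N} :
    z ∈ lieCenter E N ↔ ∀ x : GroupLieAlgebra 𝓘(ℝ, E) N, ⁅x, z⁆ = 0 :=
  haveI : CompleteSpace E := FiniteDimensional.complete ℝ E
  haveI : LieGroup 𝓘(ℝ, E) (minSmoothness ℝ 3) N := lieGroup_minSmoothness
  LieModule.mem_maxTrivSubmodule ℝ (GroupLieAlgebra 𝓘(ℝ, E) N) (GroupLieAlgebra 𝓘(ℝ, E) N) z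

/-- The metric restricted to the center of the Lie algebra is degenerate. -/
def CenterIsDegenerate (m : PseudoRiemannianMetric E N) : Prop :=
  ∃ z ∈ lieCenter E N, z ≠ 0 ∧ ∀ w ∈ lieCenter E N, m.inner 1 z w = 0

/-- The isometries preserving the left-invariant splitting `TN = VN ⊕ ZN` induced by a complement
`V` of the center `Z` of the Lie algebra. -/
def IsoSpl (m : PseudoRiemannianMetric E N) (V : Submodule ℝ (GroupLieAlgebra 𝓘(ℝ, E) N)) :
    Subgroup (Equiv.Perm N) :=
  m.IsoPreserving (leftTranslate V) (leftTranslate (lieCenter E N))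

end LieGroup

end PseudoRiemannianMetric

end

/-!
The heart of the matter is the adjoint representation `Ad`, here `groupAd`, of the connected group
`N`, together with the fact that the derivative of `g ↦ Ad g w` at the identity in direction `v` is
the bracket `⁅v, w⁆` (`hasMFDerivAt_groupAd_one`). That fact follows by writing the product in a
chart `φ` at the identity as `μ (a, b)`. The identity `L_g = R_g ∘ conj g` gives
`∂₂μ(a, e) w = ∂₁μ(e, a) (Ad a w)`, and differentiating it at `a = e` gives the bracket of
left-invariant vector fields, because the second derivative of `μ` is symmetric.

A map with vanishing derivative on a connected manifold is constant. Applied to `g ↦ Ad g w`, this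
shows that the center of the Lie algebra is the space of vectors fixed by all `Ad g`
(`mem_lieCenter_iff_groupAd`); applied to `x ↦ n x n⁻¹ x⁻¹`, it shows that `Ad n = 1` forces `n` to
be central (`mem_center_of_groupAd_eq_id`). If all commutators of `n` are central, then
`x ↦ n x n⁻¹ x⁻¹` is fixed by every conjugation, so its derivative `Ad n - 1` at the identity takes
values in the center of the Lie algebra (`groupAd_sub_mem_lieCenter`).

Take a noncentral `n`, which exists because `N` has class two, and `v` with `Ad n v ≠ v`.

* Bi-invariance makes `Ad n` orthogonal. As `Ad n` fixes every central `w`, one has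
  `⟨Ad n v - v, w⟩ = ⟨Ad n v, Ad n w⟩ - ⟨v, w⟩ = 0`, so the center is degenerate.
* If conjugation by `n` preserved the splitting given by `V`, then `Ad n u - u` would lie in both
  `V` and the center for each `u ∈ V`, so `Ad n` would be the identity on `V`, hence everywhere.
* The inversion has derivative `-1` at the identity and intertwines left and right translations, so
  it is an isometry; as it fixes the identity, it could lie in `IsoAut` only as an automorphism,
  which would make `N` abelian.
-/

section

open scoped Manifold ContDiff Topology
open Set Filter PseudoRiemannianMetric VectorField

/-! ### Maps between manifolds read in charts -/

section
variable {E : Type*} [NormedAddCommGroup E] [NormedSpace ℝ E]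
  {M : Type*} [TopologicalSpace M] [ChartedSpace E M]
  {E' : Type*} [NormedAddCommGroup E'] [NormedSpace ℝ E']
  {M' : Type*} [TopologicalSpace M'] [ChartedSpace E' M']

theorem hasMFDerivAt_extChartAt_self (x : M) :
    HasMFDerivAt 𝓘(ℝ, E) 𝓘(ℝ, E) (extChartAt 𝓘(ℝ, E) x) x
      (ContinuousLinearMap.id ℝ E : E →L[ℝ] E) := by
  refine ⟨continuousAt_extChartAt x, ?_⟩
  rw [modelWithCornersSelf_coe, range_id]
  refine HasFDerivAt.hasFDerivWithinAt (E := E) (F := E) ?_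
  refine (hasFDerivAt_id (𝕜 := ℝ) (E := E) _).congr_of_eventuallyEq ?_
  filter_upwards [extChartAt_target_mem_nhds (I := 𝓘(ℝ, E)) x] with a ha
  exact (extChartAt 𝓘(ℝ, E) x).right_inv ha

theorem hasMFDerivAt_extChartAt_symm_self (x : M) :
    HasMFDerivAt 𝓘(ℝ, E) 𝓘(ℝ, E) (extChartAt 𝓘(ℝ, E) x).symm (extChartAt 𝓘(ℝ, E) x x)
      (ContinuousLinearMap.id ℝ E : E →L[ℝ] E) := by
  refine ⟨continuousAt_extChartAt_symm x, ?_⟩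
  rw [modelWithCornersSelf_coe, range_id]
  refine HasFDerivAt.hasFDerivWithinAt (E := E) (F := E) ?_
  refine (hasFDerivAt_id (𝕜 := ℝ) (E := E) _).congr_of_eventuallyEq ?_
  filter_upwards [extChartAt_target_mem_nhds (I := 𝓘(ℝ, E)) x] with a ha
  simp only [writtenInExtChartAt, extChartAt_to_inv]
  exact (extChartAt 𝓘(ℝ, E) x).right_inv ha

/-- Since every tangent space is the model space by definition, a derivative stated as a map of
model spaces can be moved along an equality of base points. -/
theorem HasMFDerivAt.congr_point {f : M → M'} {x y : M} {L : E →L[ℝ] E'}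
    (hf : HasMFDerivAt 𝓘(ℝ, E) 𝓘(ℝ, E') f x L) (h : x = y) :
    HasMFDerivAt 𝓘(ℝ, E) 𝓘(ℝ, E') f y L := by
  subst h
  exact hf

/-- In the chart at `x`, a map sending `x` to `y` has derivative `dφ_y ∘ L`: no correction appears
at the source, as the chart at `x` has derivative the identity at `x`. -/
theorem hasFDerivAt_comp_extChartAt_symm [IsManifold 𝓘(ℝ, E) 1 M] {f : M → M} {x y : M}
    {L : E →L[ℝ] E} (hf : HasMFDerivAt 𝓘(ℝ, E) 𝓘(ℝ, E) f x L) (hfx : f x = y)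
    (hy : y ∈ (extChartAt 𝓘(ℝ, E) x).source) :
    HasFDerivAt (fun a ↦ extChartAt 𝓘(ℝ, E) x (f ((extChartAt 𝓘(ℝ, E) x).symm a)))
      ((mfderiv 𝓘(ℝ, E) 𝓘(ℝ, E) (extChartAt 𝓘(ℝ, E) x) y : E →L[ℝ] E) ∘L L)
      (extChartAt 𝓘(ℝ, E) x x) := by
  subst hfx
  have h2 : MDifferentiableAt 𝓘(ℝ, E) 𝓘(ℝ, E) (extChartAt 𝓘(ℝ, E) x) (f x) :=
    mdifferentiableAt_extChartAt (by simpa using hy)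
  have h3 := h2.hasMFDerivAt.comp x hf
  have e : (extChartAt 𝓘(ℝ, E) x).symm (extChartAt 𝓘(ℝ, E) x x) = x := extChartAt_to_inv x
  have h4 := HasMFDerivAt.comp (I' := 𝓘(ℝ, E)) (x := extChartAt 𝓘(ℝ, E) x x)
    (g := extChartAt 𝓘(ℝ, E) x ∘ f)
    (g' := (mfderiv 𝓘(ℝ, E) 𝓘(ℝ, E) (extChartAt 𝓘(ℝ, E) x) (f x) : E →L[ℝ] E) ∘L L)
    (HasMFDerivAt.congr_point h3 e.symm)
    (hasMFDerivAt_extChartAt_symm_self x)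
  exact h4.hasFDerivAt

/-- A local product `μ` on `E` with unit `e`, and a map `F` that plays the role of `a ↦ Ad a w`: if
`F` turns left-invariant vector fields into right-invariant ones, then its derivative at the unit is
the bracket of the left-invariant fields. -/
theorem fderiv_eq_lieBracket_of_fderiv_mul {μ : E × E → E} {e : E} {F : E → E}
    (hμ : ContDiffAt ℝ 2 μ (e, e)) (hl : ∀ᶠ b in 𝓝 e, μ (e, b) = b)
    (hr : ∀ᶠ a in 𝓝 e, μ (a, e) = a) (hF : DifferentiableAt ℝ F e)
    (h : ∀ᶠ a in 𝓝 e, fderiv ℝ μ (a, e) (0, F e) = fderiv ℝ μ (e, a) (F a, 0)) (v : E) :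
    fderiv ℝ F e v = lieBracket ℝ (fun a ↦ fderiv ℝ μ (a, e) (0, v))
      (fun a ↦ fderiv ℝ μ (a, e) (0, F e)) e := by
  have hd := (hμ.differentiableAt (by norm_num)).hasFDerivAt
  have hD := ((hμ.fderiv_right (m := 1) (by norm_num)).differentiableAt
    (by norm_num)).hasFDerivAt
  have hsymm : IsSymmSndFDerivAt ℝ μ (e, e) := hμ.isSymmSndFDerivAt (by simp)
  set D := fderiv ℝ μ with hDdef
  set D' := fderiv ℝ D (e, e) with hD'
  have hleft : HasFDerivAt (fun a : E ↦ (a, e)) (ContinuousLinearMap.inl ℝ E E) e :=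
    hasFDerivAt_prodMk_left e e
  have hright : HasFDerivAt (fun a : E ↦ (e, a)) (ContinuousLinearMap.inr ℝ E E) e :=
    hasFDerivAt_prodMk_right e e
  have hone (u : E) : D (e, e) (u, 0) = u := by
    have h1 : HasFDerivAt (fun a ↦ μ (a, e)) (D (e, e) ∘L ContinuousLinearMap.inl ℝ E E) e :=
      HasFDerivAt.comp (g := μ) e hd hleft
    have h2 := h1.unique ((hasFDerivAt_id e).congr_of_eventuallyEq hr)
    simpa using congrArg (· u) h2
  have hone' (u : E) : D (e, e) (0, u) = u := by
    have h1 : HasFDerivAt (fun a ↦ μ (e, a)) (D (e, e) ∘L ContinuousLinearMap.inr ℝ E E) e :=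
      HasFDerivAt.comp (g := μ) e hd hright
    have h2 := h1.unique ((hasFDerivAt_id e).congr_of_eventuallyEq hl)
    simpa using congrArg (· u) h2
  have hDl : HasFDerivAt (fun a ↦ D (a, e)) (D' ∘L ContinuousLinearMap.inl ℝ E E) e :=
    HasFDerivAt.comp (g := D) e hD hleft
  have hDr : HasFDerivAt (fun a ↦ D (e, a)) (D' ∘L ContinuousLinearMap.inr ℝ E E) e :=
    HasFDerivAt.comp (g := D) e hD hright
  have hV (u : E) := hDl.clm_apply (hasFDerivAt_const ((0 : E), u) e)
  have hR := hDr.clm_apply (hF.hasFDerivAt.prodMk (hasFDerivAt_const (0 : E) e))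
  -- Both sides of `h` are differentiated at `e`.
  have key := (hV (F e)).unique (hR.congr_of_eventuallyEq h)
  have key' := congrArg (· v) key
  simp only [add_apply, ContinuousLinearMap.comp_apply,
    ContinuousLinearMap.flip_apply, ContinuousLinearMap.inl_apply, ContinuousLinearMap.inr_apply,
    zero_apply, ContinuousLinearMap.prod_apply, map_zero, hone, zero_add] at key'
  rw [lieBracket, (hV v).fderiv, (hV (F e)).fderiv]
  simp only [add_apply, ContinuousLinearMap.comp_apply,
    ContinuousLinearMap.flip_apply, ContinuousLinearMap.inl_apply,
    zero_apply, map_zero, hone', zero_add]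
  rw [key', hsymm.eq (F e, 0) (0, v)]
  abel

theorem eventually_eq_of_hasMFDerivAt_zero [IsManifold 𝓘(ℝ, E) 1 M]
    [IsManifold 𝓘(ℝ, E') 1 M'] {f : M → M'}
    (hf : ∀ x, HasMFDerivAt 𝓘(ℝ, E) 𝓘(ℝ, E') f x (0 : E →L[ℝ] E')) (x : M) :
    ∀ᶠ y in 𝓝 x, f y = f x := by
  set φ := extChartAt 𝓘(ℝ, E) x with hφ
  set ψ := extChartAt 𝓘(ℝ, E') (f x) with hψ
  have hs : ∀ᶠ a in 𝓝 (φ x), a ∈ φ.target ∧ f (φ.symm a) ∈ ψ.source := by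
    refine Filter.Eventually.and (extChartAt_target_mem_nhds x) ?_
    have hc : ContinuousAt (f ∘ φ.symm) (φ x) := by
      refine ContinuousAt.comp ?_ (continuousAt_extChartAt_symm x)
      exact (hf _).continuousAt
    refine hc (?_ : ψ.source ∈ 𝓝 (f (φ.symm (φ x))))
    rw [extChartAt_to_inv]
    exact extChartAt_source_mem_nhds (f x)
  have hd : ∀ᶠ a in 𝓝 (φ x), HasFDerivAt (ψ ∘ f ∘ φ.symm) (0 : E →L[ℝ] E') a := by
    filter_upwards [hs] with a ha
    have h1 : MDifferentiableAt 𝓘(ℝ, E) 𝓘(ℝ, E) φ.symm a := by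
      have := mdifferentiableOn_extChartAt_symm (I := 𝓘(ℝ, E)) (x := x) a ha.1
      exact this.mdifferentiableAt ((isOpen_extChartAt_target x).mem_nhds ha.1)
    have h2 : MDifferentiableAt 𝓘(ℝ, E') 𝓘(ℝ, E') ψ (f (φ.symm a)) :=
      mdifferentiableAt_extChartAt (by simpa [hψ] using ha.2)
    have h3 := h2.hasMFDerivAt.comp a ((hf (φ.symm a)).comp a h1.hasMFDerivAt)
    have h4 := h3.hasFDerivAt
    have h5 : (mfderiv 𝓘(ℝ, E') 𝓘(ℝ, E') ψ (f (φ.symm a))) ∘L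
        ((0 : E →L[ℝ] E') ∘L (mfderiv 𝓘(ℝ, E) 𝓘(ℝ, E) φ.symm a)) = (0 : E →L[ℝ] E') :=
      ContinuousLinearMap.ext fun v ↦ map_zero (mfderiv 𝓘(ℝ, E') 𝓘(ℝ, E') ψ (f (φ.symm a)))
    exact h5 ▸ h4
  obtain ⟨r, hr, hball⟩ := Metric.eventually_nhds_iff_ball.1 (hs.and hd)
  have key : ∀ a ∈ Metric.ball (φ x) r, f (φ.symm a) = f x := by
    intro a ha
    have h0 := (convex_ball (φ x) r).is_const_of_fderivWithin_eq_zero (𝕜 := ℝ)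
      (f := ψ ∘ f ∘ φ.symm)
      (fun b hb ↦ (hball b hb).2.differentiableAt.differentiableWithinAt)
      (fun b hb ↦ by
        rw [fderivWithin_of_isOpen Metric.isOpen_ball hb, (hball b hb).2.fderiv])
      ha (Metric.mem_ball_self hr)
    simp only [Function.comp_apply, hφ, extChartAt_to_inv] at h0
    exact ψ.injOn (hball a ha).1.2 (mem_extChartAt_source (f x)) h0
  filter_upwards [extChartAt_source_mem_nhds (I := 𝓘(ℝ, E)) x,
    continuousAt_extChartAt (I := 𝓘(ℝ, E)) x (Metric.ball_mem_nhds _ hr)] with y hy hy'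
  rw [← key _ hy', φ.left_inv hy]

theorem eq_of_hasMFDerivAt_zero [IsManifold 𝓘(ℝ, E) 1 M]
    [IsManifold 𝓘(ℝ, E') 1 M'] [PreconnectedSpace M] {f : M → M'}
    (hf : ∀ x, HasMFDerivAt 𝓘(ℝ, E) 𝓘(ℝ, E') f x (0 : E →L[ℝ] E')) (x y : M) : f x = f y :=
  ((IsLocallyConstant.iff_eventually_eq f).2
    (eventually_eq_of_hasMFDerivAt_zero hf)).apply_eq_of_preconnectedSpace x y

/-- The bracket at `x` may be computed from any representatives `V'` and `W'` of the vector fields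
near `x`, read in the chart at `x`. -/
theorem mlieBracket_eq_lieBracket_extChartAt [IsManifold 𝓘(ℝ, E) 1 M]
    [CompleteSpace E] (V W : ∀ x : M, TangentSpace 𝓘(ℝ, E) x) (x : M)
    {V' W' : E → E}
    (hV : ∀ᶠ y in 𝓝 x, V' (extChartAt 𝓘(ℝ, E) x y)
      = mfderiv 𝓘(ℝ, E) 𝓘(ℝ, E) (extChartAt 𝓘(ℝ, E) x) y (V y))
    (hW : ∀ᶠ y in 𝓝 x, W' (extChartAt 𝓘(ℝ, E) x y)
      = mfderiv 𝓘(ℝ, E) 𝓘(ℝ, E) (extChartAt 𝓘(ℝ, E) x) y (W y)) :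
    mlieBracket 𝓘(ℝ, E) V W x = lieBracket ℝ V' W' (extChartAt 𝓘(ℝ, E) x x) := by
  set φ := extChartAt 𝓘(ℝ, E) x with hφ
  have key (V : ∀ x : M, TangentSpace 𝓘(ℝ, E) x) (V' : E → E)
      (hV : ∀ᶠ y in 𝓝 x, V' (φ y) = mfderiv 𝓘(ℝ, E) 𝓘(ℝ, E) φ y (V y)) :
      mpullbackWithin 𝓘(ℝ, E) 𝓘(ℝ, E) φ.symm V univ =ᶠ[𝓝 (φ x)] V' := by
    have hV2 : ∀ᶠ a in 𝓝 (φ x), V' (φ (φ.symm a)) =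
        mfderiv 𝓘(ℝ, E) 𝓘(ℝ, E) φ (φ.symm a) (V (φ.symm a)) := by
      refine (continuousAt_extChartAt_symm (I := 𝓘(ℝ, E)) x).eventually
        (p := fun y ↦ V' (φ y) = mfderiv 𝓘(ℝ, E) 𝓘(ℝ, E) φ y (V y)) ?_
      rwa [extChartAt_to_inv]
    filter_upwards [hV2, extChartAt_target_mem_nhds (I := 𝓘(ℝ, E)) x] with a ha hat
    rw [φ.right_inv hat] at ha
    rw [ha, mpullbackWithin_apply]
    have h1 := mfderiv_extChartAt_comp_mfderivWithin_extChartAt_symm (I := 𝓘(ℝ, E)) hat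
    have h2 := mfderivWithin_extChartAt_symm_comp_mfderiv_extChartAt (I := 𝓘(ℝ, E)) hat
    rw [modelWithCornersSelf_coe, range_id] at h1 h2
    rw [ContinuousLinearMap.inverse_eq h2 h1]
  rw [← mlieBracketWithin_univ, mlieBracketWithin_apply]
  rw [modelWithCornersSelf_coe, range_id, preimage_univ, inter_univ, ← hφ]
  have h1 : lieBracketWithin (E := E) ℝ (mpullbackWithin 𝓘(ℝ, E) 𝓘(ℝ, E) φ.symm V univ)
      (mpullbackWithin 𝓘(ℝ, E) 𝓘(ℝ, E) φ.symm W univ) univ (φ x) = lieBracket ℝ V' W' (φ x) := by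
    refine (congrFun lieBracketWithin_univ _).trans ?_
    exact Filter.EventuallyEq.lieBracket_vectorField_eq (key V V' hV) (key W W' hW)
  have h2 : (mfderiv 𝓘(ℝ, E) 𝓘(ℝ, E) φ x).inverse = (ContinuousLinearMap.id ℝ E : E →L[ℝ] E) := by
    rw [(hasMFDerivAt_extChartAt_self x).mfderiv]
    exact ContinuousLinearMap.inverse_id
  rw [h2]
  exact h1
end

noncomputable section
variable {E : Type*} [NormedAddCommGroup E] [NormedSpace ℝ E]
  {N : Type*} [TopologicalSpace N] [ChartedSpace E N] [Group N]

/-! ### The adjoint representation and the bracket -/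

/-- The adjoint action of `g`: the derivative of conjugation by `g` at the identity. It is recorded
as an endomorphism of the model space `E`, which by definition is the tangent space both at `1` and
at `g * 1 * g⁻¹`. -/
def groupAd (g : N) : E →L[ℝ] E :=
  mfderiv 𝓘(ℝ, E) 𝓘(ℝ, E) (fun x : N ↦ g * x * g⁻¹) (1 : N)

variable [LieGroup 𝓘(ℝ, E) ∞ N]

theorem contMDiff_conj (g : N) : ContMDiff 𝓘(ℝ, E) 𝓘(ℝ, E) ∞ (fun x : N ↦ g * x * g⁻¹) :=
  (contMDiff_mul_right (I := 𝓘(ℝ, E)) (n := ∞) (a := g⁻¹)).comp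
    (contMDiff_mul_left (I := 𝓘(ℝ, E)) (n := ∞) (a := g))

theorem hasMFDerivAt_conj_one (g : N) :
    HasMFDerivAt 𝓘(ℝ, E) 𝓘(ℝ, E) (fun x : N ↦ g * x * g⁻¹) 1 (groupAd (E := E) g) :=
  ((contMDiff_conj (E := E) g).mdifferentiable (by simp) 1).hasMFDerivAt

theorem groupAd_mul (g h : N) :
    groupAd (E := E) (g * h) = groupAd (E := E) g ∘L groupAd (E := E) h := by
  have h1 : HasMFDerivAt 𝓘(ℝ, E) 𝓘(ℝ, E) (fun x : N ↦ g * x * g⁻¹) (h * 1 * h⁻¹)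
      (groupAd (E := E) g) := HasMFDerivAt.congr_point (hasMFDerivAt_conj_one g)
      (show (1 : N) = h * 1 * h⁻¹ by simp)
  have h2 := HasMFDerivAt.comp (I' := 𝓘(ℝ, E)) 1 h1 (hasMFDerivAt_conj_one h)
  have h3 : (fun x : N ↦ g * x * g⁻¹) ∘ (fun x ↦ h * x * h⁻¹)
      = fun x ↦ (g * h) * x * (g * h)⁻¹ := by
    ext x; simp [mul_assoc]
  rw [h3] at h2
  exact h2.mfderiv

theorem contDiffAt_chart_mul :
    ContDiffAt ℝ ∞ (fun p : E × E ↦ extChartAt 𝓘(ℝ, E) (1 : N)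
      ((extChartAt 𝓘(ℝ, E) (1 : N)).symm p.1 * (extChartAt 𝓘(ℝ, E) (1 : N)).symm p.2))
      (extChartAt 𝓘(ℝ, E) (1 : N) 1, extChartAt 𝓘(ℝ, E) (1 : N) 1) := by
  set φ := extChartAt 𝓘(ℝ, E) (1 : N) with hφ
  have hsymm : ContMDiffAt 𝓘(ℝ, E) 𝓘(ℝ, E) ∞ φ.symm (φ 1) :=
    (contMDiffOn_extChartAt_symm 1).contMDiffAt (extChartAt_target_mem_nhds 1)
  have e : φ.symm (φ 1) = 1 := extChartAt_to_inv 1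
  rw [← contMDiffAt_iff_contDiffAt]
  have h1 : ContMDiffAt 𝓘(ℝ, E × E) 𝓘(ℝ, E) ∞ (fun p : E × E ↦ φ.symm p.1)
      (φ 1, φ 1) := ContMDiffAt.comp (x := (φ 1, φ 1)) (I' := 𝓘(ℝ, E)) hsymm
        contDiff_fst.contMDiff.contMDiffAt
  have h2 : ContMDiffAt 𝓘(ℝ, E × E) 𝓘(ℝ, E) ∞ (fun p : E × E ↦ φ.symm p.2)
      (φ 1, φ 1) := ContMDiffAt.comp (x := (φ 1, φ 1)) (I' := 𝓘(ℝ, E)) hsymm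
        contDiff_snd.contMDiff.contMDiffAt
  have h3 := h1.mul h2
  have h4 : ContMDiffAt 𝓘(ℝ, E) 𝓘(ℝ, E) ∞ φ (φ.symm (φ 1) * φ.symm (φ 1)) := by
    rw [e, mul_one]
    exact contMDiffAt_extChartAt
  exact ContMDiffAt.comp (x := (φ 1, φ 1)) (I' := 𝓘(ℝ, E)) h4 h3

theorem contDiffAt_chart_conj :
    ContDiffAt ℝ ∞ (fun p : E × E ↦ extChartAt 𝓘(ℝ, E) (1 : N)
      ((extChartAt 𝓘(ℝ, E) (1 : N)).symm p.1 * (extChartAt 𝓘(ℝ, E) (1 : N)).symm p.2 *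
        ((extChartAt 𝓘(ℝ, E) (1 : N)).symm p.1)⁻¹))
      (extChartAt 𝓘(ℝ, E) (1 : N) 1, extChartAt 𝓘(ℝ, E) (1 : N) 1) := by
  set φ := extChartAt 𝓘(ℝ, E) (1 : N) with hφ
  have hsymm : ContMDiffAt 𝓘(ℝ, E) 𝓘(ℝ, E) ∞ φ.symm (φ 1) :=
    (contMDiffOn_extChartAt_symm 1).contMDiffAt (extChartAt_target_mem_nhds 1)
  have e : φ.symm (φ 1) = 1 := extChartAt_to_inv 1
  rw [← contMDiffAt_iff_contDiffAt]
  have h1 : ContMDiffAt 𝓘(ℝ, E × E) 𝓘(ℝ, E) ∞ (fun p : E × E ↦ φ.symm p.1)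
      (φ 1, φ 1) := ContMDiffAt.comp (x := (φ 1, φ 1)) (I' := 𝓘(ℝ, E)) hsymm
        contDiff_fst.contMDiff.contMDiffAt
  have h2 : ContMDiffAt 𝓘(ℝ, E × E) 𝓘(ℝ, E) ∞ (fun p : E × E ↦ φ.symm p.2)
      (φ 1, φ 1) := ContMDiffAt.comp (x := (φ 1, φ 1)) (I' := 𝓘(ℝ, E)) hsymm
        contDiff_snd.contMDiff.contMDiffAt
  have h3 := (h1.mul h2).mul h1.inv
  have h4 : ContMDiffAt 𝓘(ℝ, E) 𝓘(ℝ, E) ∞ φ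
      (φ.symm (φ 1) * φ.symm (φ 1) * (φ.symm (φ 1))⁻¹) := by
    rw [e, mul_one, mul_inv_cancel]
    exact contMDiffAt_extChartAt
  exact ContMDiffAt.comp (x := (φ 1, φ 1)) (I' := 𝓘(ℝ, E)) h4 h3

theorem fderiv_apply_inr {μ : E × E → E} {a b w : E} {L : E →L[ℝ] E}
    (hμ : DifferentiableAt ℝ μ (a, b)) (h : HasFDerivAt (fun x ↦ μ (a, x)) L b) :
    fderiv ℝ μ (a, b) (0, w) = L w := by
  have h1 := HasFDerivAt.comp (g := μ) (f := fun x ↦ (a, x)) b hμ.hasFDerivAt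
    (hasFDerivAt_prodMk_right a b)
  have h2 := congrArg (· w) (h1.unique h)
  simpa using h2

theorem fderiv_apply_inl {μ : E × E → E} {a b w : E} {L : E →L[ℝ] E}
    (hμ : DifferentiableAt ℝ μ (a, b)) (h : HasFDerivAt (fun x ↦ μ (x, b)) L a) :
    fderiv ℝ μ (a, b) (w, 0) = L w := by
  have h1 := HasFDerivAt.comp (g := μ) (f := fun x ↦ (x, b)) a hμ.hasFDerivAt
    (hasFDerivAt_prodMk_left a b)
  have h2 := congrArg (· w) (h1.unique h)
  simpa using h2

/-- The derivative of the identity `g * x = (g * x * g⁻¹) * g` at `x = 1`. -/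
theorem mfderiv_mul_left_eq_comp_groupAd (g : N) :
    (mfderiv 𝓘(ℝ, E) 𝓘(ℝ, E) (fun x : N ↦ g * x) 1 : E →L[ℝ] E) =
      (mfderiv 𝓘(ℝ, E) 𝓘(ℝ, E) (fun x : N ↦ x * g) 1 : E →L[ℝ] E) ∘L groupAd (E := E) g := by
  have h1 : HasMFDerivAt 𝓘(ℝ, E) 𝓘(ℝ, E) (fun x : N ↦ x * g) (g * 1 * g⁻¹)
      (mfderiv 𝓘(ℝ, E) 𝓘(ℝ, E) (fun x : N ↦ x * g) 1 : E →L[ℝ] E) :=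
    HasMFDerivAt.congr_point ((contMDiff_mul_right (I := 𝓘(ℝ, E)) (n := ∞)
      (a := g)).mdifferentiable (by simp) 1).hasMFDerivAt
      (show (1 : N) = g * 1 * g⁻¹ by simp)
  have h2 := HasMFDerivAt.comp (I' := 𝓘(ℝ, E)) 1 h1 (hasMFDerivAt_conj_one g)
  have h3 : (fun x : N ↦ x * g) ∘ (fun x ↦ g * x * g⁻¹) = fun x ↦ g * x := by
    ext x; simp
  rw [h3] at h2
  exact h2.mfderiv

/-- The adjoint action near the identity as a partial derivative of conjugation read in the chart,
from which its differentiability follows. -/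
theorem eventually_groupAd_chart (w : E) :
    ∀ᶠ a in 𝓝 (extChartAt 𝓘(ℝ, E) (1 : N) 1),
      groupAd ((extChartAt 𝓘(ℝ, E) (1 : N)).symm a) w =
        fderiv ℝ (fun p : E × E ↦ extChartAt 𝓘(ℝ, E) (1 : N)
          ((extChartAt 𝓘(ℝ, E) (1 : N)).symm p.1 * (extChartAt 𝓘(ℝ, E) (1 : N)).symm p.2 *
            ((extChartAt 𝓘(ℝ, E) (1 : N)).symm p.1)⁻¹))
          (a, extChartAt 𝓘(ℝ, E) (1 : N) 1) (0, w) := by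
  have : IsManifold 𝓘(ℝ, E) 1 N := IsManifold.of_le (n := ∞) (by simp)
  have hc := ((contDiffAt_chart_conj (E := E) (N := N)).of_le
    (show (1 : ℕ∞ω) ≤ ∞ by simp)).eventually (by simp)
  set φ := extChartAt 𝓘(ℝ, E) (1 : N) with hφ
  have hpair : ContinuousAt (fun a : E ↦ (a, φ 1)) (φ 1) := by fun_prop
  filter_upwards [hpair.eventually hc] with a ha
  have h1 := hasFDerivAt_comp_extChartAt_symm (hasMFDerivAt_conj_one (E := E) (φ.symm a))
    (show φ.symm a * 1 * (φ.symm a)⁻¹ = 1 by simp) (mem_extChartAt_source (1 : N))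
  rw [fderiv_apply_inr (ha.differentiableAt (by simp)) h1,
    (hasMFDerivAt_extChartAt_self (1 : N)).mfderiv]
  rfl

/-- The partial derivative of the product read in the chart represents the left-invariant vector
fields near the identity. -/
theorem eventually_mul_left_chart :
    ∀ᶠ g in 𝓝 (1 : N), ∀ w : E, fderiv ℝ (fun p : E × E ↦ extChartAt 𝓘(ℝ, E) (1 : N)
          ((extChartAt 𝓘(ℝ, E) (1 : N)).symm p.1 * (extChartAt 𝓘(ℝ, E) (1 : N)).symm p.2))
          (extChartAt 𝓘(ℝ, E) (1 : N) g, extChartAt 𝓘(ℝ, E) (1 : N) 1) (0, w) =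
        (mfderiv 𝓘(ℝ, E) 𝓘(ℝ, E) (extChartAt 𝓘(ℝ, E) (1 : N)) g : E →L[ℝ] E)
          ((mfderiv 𝓘(ℝ, E) 𝓘(ℝ, E) (fun x : N ↦ g * x) 1 : E →L[ℝ] E) w) := by
  have : IsManifold 𝓘(ℝ, E) 1 N := IsManifold.of_le (n := ∞) (by simp)
  have hc := ((contDiffAt_chart_mul (E := E) (N := N)).of_le
    (show (1 : ℕ∞ω) ≤ ∞ by simp)).eventually (by simp)
  set φ := extChartAt 𝓘(ℝ, E) (1 : N) with hφ
  have hpair : ContinuousAt (fun g : N ↦ (φ g, φ 1)) 1 :=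
    (continuousAt_extChartAt 1).prodMk continuousAt_const
  filter_upwards [hpair.eventually hc, extChartAt_source_mem_nhds (I := 𝓘(ℝ, E)) (1 : N)]
    with g ha hg w
  have hm : HasMFDerivAt 𝓘(ℝ, E) 𝓘(ℝ, E) (fun x : N ↦ g * x) 1
      (mfderiv 𝓘(ℝ, E) 𝓘(ℝ, E) (fun x : N ↦ g * x) 1 : E →L[ℝ] E) :=
    ((contMDiff_mul_left (I := 𝓘(ℝ, E)) (n := ∞) (a := g)).mdifferentiable
      (by simp) 1).hasMFDerivAt
  have h1 := hasFDerivAt_comp_extChartAt_symm hm (mul_one g) hg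
  have e : φ.symm (φ g) = g := φ.left_inv hg
  refine fderiv_apply_inr (E := E)
    (L := (mfderiv 𝓘(ℝ, E) 𝓘(ℝ, E) φ g : E →L[ℝ] E) ∘L
      (mfderiv 𝓘(ℝ, E) 𝓘(ℝ, E) (fun x : N ↦ g * x) 1 : E →L[ℝ] E))
    (ha.differentiableAt (by simp)) ?_
  simp only [e]
  exact h1

/-- The partial derivative of the product read in the chart represents the right-invariant vector
fields near the identity. -/
theorem eventually_mul_right_chart :
    ∀ᶠ g in 𝓝 (1 : N), ∀ w : E, fderiv ℝ (fun p : E × E ↦ extChartAt 𝓘(ℝ, E) (1 : N)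
          ((extChartAt 𝓘(ℝ, E) (1 : N)).symm p.1 * (extChartAt 𝓘(ℝ, E) (1 : N)).symm p.2))
          (extChartAt 𝓘(ℝ, E) (1 : N) 1, extChartAt 𝓘(ℝ, E) (1 : N) g) (w, 0) =
        (mfderiv 𝓘(ℝ, E) 𝓘(ℝ, E) (extChartAt 𝓘(ℝ, E) (1 : N)) g : E →L[ℝ] E)
          ((mfderiv 𝓘(ℝ, E) 𝓘(ℝ, E) (fun x : N ↦ x * g) 1 : E →L[ℝ] E) w) := by
  have : IsManifold 𝓘(ℝ, E) 1 N := IsManifold.of_le (n := ∞) (by simp)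
  have hc := ((contDiffAt_chart_mul (E := E) (N := N)).of_le
    (show (1 : ℕ∞ω) ≤ ∞ by simp)).eventually (by simp)
  set φ := extChartAt 𝓘(ℝ, E) (1 : N) with hφ
  have hpair : ContinuousAt (fun g : N ↦ (φ 1, φ g)) 1 :=
    continuousAt_const.prodMk (continuousAt_extChartAt 1)
  filter_upwards [hpair.eventually hc, extChartAt_source_mem_nhds (I := 𝓘(ℝ, E)) (1 : N)]
    with g ha hg w
  have hm : HasMFDerivAt 𝓘(ℝ, E) 𝓘(ℝ, E) (fun x : N ↦ x * g) 1
      (mfderiv 𝓘(ℝ, E) 𝓘(ℝ, E) (fun x : N ↦ x * g) 1 : E →L[ℝ] E) :=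
    ((contMDiff_mul_right (I := 𝓘(ℝ, E)) (n := ∞) (a := g)).mdifferentiable
      (by simp) 1).hasMFDerivAt
  have h1 := hasFDerivAt_comp_extChartAt_symm hm (one_mul g) hg
  have e : φ.symm (φ g) = g := φ.left_inv hg
  refine fderiv_apply_inl (E := E)
    (L := (mfderiv 𝓘(ℝ, E) 𝓘(ℝ, E) φ g : E →L[ℝ] E) ∘L
      (mfderiv 𝓘(ℝ, E) 𝓘(ℝ, E) (fun x : N ↦ x * g) 1 : E →L[ℝ] E))
    (ha.differentiableAt (by simp)) ?_
  simp only [e]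
  exact h1

theorem differentiableAt_groupAd_chart (w : E) :
    DifferentiableAt ℝ (fun a ↦ groupAd ((extChartAt 𝓘(ℝ, E) (1 : N)).symm a) w)
      (extChartAt 𝓘(ℝ, E) (1 : N) 1) := by
  refine DifferentiableAt.congr_of_eventuallyEq ?_ (eventually_groupAd_chart (N := N) w)
  have h1 := (((contDiffAt_chart_conj (E := E) (N := N)).of_le (show (2 : ℕ∞ω) ≤ ∞ from
    WithTop.coe_le_coe.2 le_top)).fderiv_right (m := 1) (by norm_num)).differentiableAt (by simp)
  refine DifferentiableAt.clm_apply ?_ (differentiableAt_const _)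
  exact DifferentiableAt.comp (extChartAt 𝓘(ℝ, E) (1 : N) 1) h1
    (f := fun a ↦ (a, extChartAt 𝓘(ℝ, E) (1 : N) 1)) (by fun_prop)

theorem mdifferentiableAt_groupAd (w : E) :
    MDifferentiableAt 𝓘(ℝ, E) 𝓘(ℝ, E) (fun g : N ↦ groupAd g w) 1 := by
  have : IsManifold 𝓘(ℝ, E) 1 N := IsManifold.of_le (n := ∞) (by simp)
  have h1 := MDifferentiableAt.comp (I' := 𝓘(ℝ, E)) (1 : N)
    (differentiableAt_groupAd_chart (N := N) w).mdifferentiableAt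
    (mdifferentiableAt_extChartAt (I := 𝓘(ℝ, E)) (x := (1 : N)) (y := 1) (mem_chart_source E 1))
  refine h1.congr_of_eventuallyEq ?_
  filter_upwards [extChartAt_source_mem_nhds (I := 𝓘(ℝ, E)) (1 : N)] with g hg
  simp only [Function.comp_apply, (extChartAt 𝓘(ℝ, E) (1 : N)).left_inv hg]

theorem groupAd_one : groupAd (E := E) (1 : N) = ContinuousLinearMap.id ℝ E := by
  have h := hasMFDerivAt_conj_one (E := E) (1 : N)
  have e : (fun x : N ↦ 1 * x * 1⁻¹) = id := by ext; simp
  rw [e] at h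
  exact h.mfderiv.symm.trans mfderiv_id

/-- The derivative of the adjoint representation is the bracket: `d(g ↦ Ad g w)₁ v = ⁅v, w⁆`. -/
theorem hasMFDerivAt_groupAd_one [CompleteSpace E] (w : GroupLieAlgebra 𝓘(ℝ, E) N) :
    ∃ L : E →L[ℝ] E, HasMFDerivAt 𝓘(ℝ, E) 𝓘(ℝ, E) (fun g : N ↦ groupAd (E := E) g w) 1 L ∧
      ∀ v : GroupLieAlgebra 𝓘(ℝ, E) N, L v = ⁅v, w⁆ := by
  have : IsManifold 𝓘(ℝ, E) 1 N := IsManifold.of_le (n := ∞) (by simp)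
  have hl := eventually_mul_left_chart (E := E) (N := N)
  have hr := eventually_mul_right_chart (E := E) (N := N)
  have hμ := (contDiffAt_chart_mul (E := E) (N := N)).of_le (show (2 : ℕ∞ω) ≤ ∞ from
    WithTop.coe_le_coe.2 le_top)
  have hF := differentiableAt_groupAd_chart (E := E) (N := N) w
  have hM := (mdifferentiableAt_groupAd (E := E) (N := N) w)
  set φ := extChartAt 𝓘(ℝ, E) (1 : N) with hφ
  have e1 : φ.symm (φ 1) = 1 := extChartAt_to_inv 1
  have hF1 : groupAd (E := E) (φ.symm (φ 1)) w = w := by rw [e1, groupAd_one]; rfl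
  refine ⟨fderiv ℝ (fun a ↦ groupAd (E := E) (φ.symm a) w) (φ 1), ?_, fun v ↦ ?_⟩
  · refine ⟨hM.continuousAt, ?_⟩
    rw [modelWithCornersSelf_coe, range_id]
    exact hF.hasFDerivAt.hasFDerivWithinAt
  have ht := extChartAt_target_mem_nhds (I := 𝓘(ℝ, E)) (1 : N)
  have hsymm : Tendsto φ.symm (𝓝 (φ 1)) (𝓝 (1 : N)) := by
    have := continuousAt_extChartAt_symm (I := 𝓘(ℝ, E)) (1 : N)
    rwa [ContinuousAt, extChartAt_to_inv] at this
  have key := fderiv_eq_lieBracket_of_fderiv_mul (F := fun a ↦ groupAd (E := E) (φ.symm a) w) hμ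
    (by filter_upwards [ht] with a ha; simp only [e1, one_mul]; exact φ.right_inv ha)
    (by filter_upwards [ht] with a ha; simp only [e1, mul_one]; exact φ.right_inv ha)
    hF
    (by
      filter_upwards [ht, hsymm.eventually hl, hsymm.eventually hr] with a ha h1 h2
      rw [φ.right_inv ha] at h1 h2
      rw [h1, h2, hF1, mfderiv_mul_left_eq_comp_groupAd]
      rfl) v
  rw [key, hF1, GroupLieAlgebra.bracket_def]
  exact (mlieBracket_eq_lieBracket_extChartAt _ _ 1 (hl.mono fun g hg ↦ hg v)
    (hl.mono fun g hg ↦ hg w)).symm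

/-! ### Derivatives of the group operations, and the two centers -/

theorem hasMFDerivAt_mul_left (g x : N) :
    HasMFDerivAt 𝓘(ℝ, E) 𝓘(ℝ, E) (fun y : N ↦ g * y) x
      (mfderiv 𝓘(ℝ, E) 𝓘(ℝ, E) (fun y : N ↦ g * y) x : E →L[ℝ] E) :=
  ((contMDiff_mul_left (I := 𝓘(ℝ, E)) (n := ∞) (a := g)).mdifferentiable
    (by simp) x).hasMFDerivAt

theorem hasMFDerivAt_mul_right (g x : N) :
    HasMFDerivAt 𝓘(ℝ, E) 𝓘(ℝ, E) (fun y : N ↦ y * g) x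
      (mfderiv 𝓘(ℝ, E) 𝓘(ℝ, E) (fun y : N ↦ y * g) x : E →L[ℝ] E) :=
  ((contMDiff_mul_right (I := 𝓘(ℝ, E)) (n := ∞) (a := g)).mdifferentiable
    (by simp) x).hasMFDerivAt

theorem HasMFDerivAt.mul_of_eq_one {f h : N → N} {x : N} {L L' : E →L[ℝ] E}
    (hf : HasMFDerivAt 𝓘(ℝ, E) 𝓘(ℝ, E) f x L) (hh : HasMFDerivAt 𝓘(ℝ, E) 𝓘(ℝ, E) h x L')
    (hf1 : f x = 1) (hh1 : h x = 1) :
    HasMFDerivAt 𝓘(ℝ, E) 𝓘(ℝ, E) (fun y ↦ f y * h y) x (L + L') := by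
  have hm : MDifferentiableAt (𝓘(ℝ, E).prod 𝓘(ℝ, E)) 𝓘(ℝ, E) (fun p : N × N ↦ p.1 * p.2) (1, 1) :=
    (contMDiff_mul 𝓘(ℝ, E) ∞).mdifferentiable (by simp) _
  have hmul (u v : E) : (mfderiv (𝓘(ℝ, E).prod 𝓘(ℝ, E)) 𝓘(ℝ, E)
      (fun p : N × N ↦ p.1 * p.2) (1, 1) : E × E →L[ℝ] E) (u, v) = u + v := by
    refine (mfderiv_prod_eq_add_apply (v := (u, v)) hm).trans ?_
    have e1 : (fun z : N ↦ z * 1) = id := by ext; simp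
    have e2 : (fun z : N ↦ 1 * z) = id := by ext; simp
    have d1 : HasMFDerivAt 𝓘(ℝ, E) 𝓘(ℝ, E) (fun z : N ↦ z * 1) 1 (ContinuousLinearMap.id ℝ E) := by
      rw [e1]
      exact hasMFDerivAt_id _
    have d2 : HasMFDerivAt 𝓘(ℝ, E) 𝓘(ℝ, E) (fun z : N ↦ 1 * z) 1 (ContinuousLinearMap.id ℝ E) := by
      rw [e2]
      exact hasMFDerivAt_id _
    exact congrArg₂ (fun A B : E →L[ℝ] E ↦ A u + B v) d1.mfderiv d2.mfderiv
  have hp : HasMFDerivAt 𝓘(ℝ, E) (𝓘(ℝ, E).prod 𝓘(ℝ, E)) (fun y ↦ (f y, h y)) x (L.prod L') :=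
    hf.prodMk hh
  have hm' : HasMFDerivAt (𝓘(ℝ, E).prod 𝓘(ℝ, E)) 𝓘(ℝ, E) (fun p : N × N ↦ p.1 * p.2)
      (f x, h x) (mfderiv (𝓘(ℝ, E).prod 𝓘(ℝ, E)) 𝓘(ℝ, E)
      (fun p : N × N ↦ p.1 * p.2) (1, 1) : E × E →L[ℝ] E) := by
    rw [hf1, hh1]
    exact hm.hasMFDerivAt
  have hc := HasMFDerivAt.comp x hm' hp
  have e : (mfderiv (𝓘(ℝ, E).prod 𝓘(ℝ, E)) 𝓘(ℝ, E)
      (fun p : N × N ↦ p.1 * p.2) (1, 1) : E × E →L[ℝ] E) ∘L (L.prod L') = L + L' := by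
    ext v
    exact hmul (L v) (L' v)
  exact HasMFDerivAt.congr_mfderiv hc e

theorem hasMFDerivAt_inv_one :
    HasMFDerivAt 𝓘(ℝ, E) 𝓘(ℝ, E) (fun x : N ↦ x⁻¹) 1 (-ContinuousLinearMap.id ℝ E) := by
  obtain ⟨L, h⟩ : ∃ L : E →L[ℝ] E, HasMFDerivAt 𝓘(ℝ, E) 𝓘(ℝ, E) (fun x : N ↦ x⁻¹) 1 L :=
    ⟨_, ((contMDiff_inv 𝓘(ℝ, E) ∞).mdifferentiable (by simp) 1).hasMFDerivAt⟩
  have h1 := HasMFDerivAt.mul_of_eq_one (L := ContinuousLinearMap.id ℝ E)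
    (hasMFDerivAt_id (I := 𝓘(ℝ, E)) (1 : N)) h rfl inv_one
  have e : (fun y : N ↦ id y * y⁻¹) = fun _ ↦ 1 := by ext; simp
  rw [e] at h1
  have h2 : ContinuousLinearMap.id ℝ E + L = 0 := h1.mfderiv.symm.trans mfderiv_const
  rwa [eq_neg_of_add_eq_zero_right h2] at h

theorem hasMFDerivAt_commutator_one (n : N) :
    HasMFDerivAt 𝓘(ℝ, E) 𝓘(ℝ, E) (fun x : N ↦ n * x * n⁻¹ * x⁻¹) 1
      (groupAd (E := E) n - ContinuousLinearMap.id ℝ E) := by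
  rw [sub_eq_add_neg]
  exact (hasMFDerivAt_conj_one n).mul_of_eq_one hasMFDerivAt_inv_one (by simp) inv_one

/-- The map `x ↦ n x n⁻¹ x⁻¹` has derivative `Ad n - 1 = 0` at the identity, hence derivative zero
everywhere by translation, so it is constant. -/
theorem mem_center_of_groupAd_eq_id [PreconnectedSpace N] {n : N}
    (hn : groupAd (E := E) n = ContinuousLinearMap.id ℝ E) : n ∈ Subgroup.center N := by
  have : IsManifold 𝓘(ℝ, E) 1 N := IsManifold.of_le (n := ∞) (by simp)
  have h0 := hasMFDerivAt_commutator_one (E := E) n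
  rw [hn, sub_self] at h0
  have h (x : N) : HasMFDerivAt 𝓘(ℝ, E) 𝓘(ℝ, E) (fun x : N ↦ n * x * n⁻¹ * x⁻¹) x
      (0 : E →L[ℝ] E) := by
    have h1 : HasMFDerivAt 𝓘(ℝ, E) 𝓘(ℝ, E) (fun x : N ↦ n * x * n⁻¹ * x⁻¹) (x⁻¹ * x)
      (0 : E →L[ℝ] E) := HasMFDerivAt.congr_point h0 (inv_mul_cancel x).symm
    have h2 := HasMFDerivAt.comp (I' := 𝓘(ℝ, E)) x h1 (hasMFDerivAt_mul_left x⁻¹ x)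
    have h3 := HasMFDerivAt.comp (I' := 𝓘(ℝ, E)) x
      (hasMFDerivAt_mul_left (E := E) (n * x * n⁻¹) _) h2
    have h4 := HasMFDerivAt.comp (I' := 𝓘(ℝ, E)) x
      (hasMFDerivAt_mul_right (E := E) x⁻¹ _) h3
    -- With `h x = n x n⁻¹ x⁻¹` one has `h (x * y) = (n x n⁻¹) * h y * x⁻¹`.
    have e : (fun y : N ↦ y * x⁻¹) ∘ (fun y ↦ (n * x * n⁻¹) * y) ∘
        (fun x ↦ n * x * n⁻¹ * x⁻¹) ∘ (fun y ↦ x⁻¹ * y) = fun x ↦ n * x * n⁻¹ * x⁻¹ := by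
      ext y; simp [mul_assoc]
    rw [e] at h4
    refine HasMFDerivAt.congr_mfderiv h4 (ContinuousLinearMap.ext fun v ↦ ?_)
    have hz (A B : E →L[ℝ] E) : A (B 0) = 0 := by simp
    exact hz _ _
  rw [Subgroup.mem_center_iff]
  intro g
  have h1 := eq_of_hasMFDerivAt_zero h g 1
  simp only [mul_one, mul_inv_cancel, inv_one, mul_inv_eq_iff_eq_mul,
    one_mul] at h1
  exact h1.symm

theorem groupAd_apply_eq_of_forall_lie_eq_zero [CompleteSpace E] [PreconnectedSpace N]
    {w : GroupLieAlgebra 𝓘(ℝ, E) N} (hw : ∀ v : GroupLieAlgebra 𝓘(ℝ, E) N, ⁅v, w⁆ = 0) (g : N) :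
    groupAd (E := E) g w = w := by
  have : IsManifold 𝓘(ℝ, E) 1 N := IsManifold.of_le (n := ∞) (by simp)
  obtain ⟨L, hL, hLw⟩ := hasMFDerivAt_groupAd_one w
  have hL0 : L = 0 := by
    ext v
    exact (hLw v).trans (hw v)
  rw [hL0] at hL
  have h (x : N) : HasMFDerivAt 𝓘(ℝ, E) 𝓘(ℝ, E) (fun g : N ↦ groupAd (E := E) g w) x
      (0 : E →L[ℝ] E) := by
    have h1 := HasMFDerivAt.congr_point hL (inv_mul_cancel x).symm
    have h2 := HasMFDerivAt.comp (I' := 𝓘(ℝ, E)) x h1 (hasMFDerivAt_mul_left x⁻¹ x)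
    have h3 := HasMFDerivAt.comp (I' := 𝓘(ℝ, E)) x
      ((groupAd (E := E) x).hasMFDerivAt (x := groupAd (E := E) (x⁻¹ * x) w)) h2
    have e : (groupAd (E := E) x) ∘ (fun g : N ↦ groupAd (E := E) g w) ∘ (fun y ↦ x⁻¹ * y)
        = fun g ↦ groupAd (E := E) g w := by
      ext y
      have h4 := groupAd_mul (E := E) x (x⁻¹ * y)
      rw [mul_inv_cancel_left] at h4
      exact (congrArg (fun A : E →L[ℝ] E ↦ A w) h4).symm
    rw [e] at h3
    exact HasMFDerivAt.congr_mfderiv h3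
      (ContinuousLinearMap.ext fun v ↦ map_zero (groupAd (E := E) x))
  rw [eq_of_hasMFDerivAt_zero h g 1, groupAd_one]
  rfl

theorem lie_eq_zero_of_forall_groupAd_apply_eq [CompleteSpace E]
    {w : GroupLieAlgebra 𝓘(ℝ, E) N} (hw : ∀ g : N, groupAd (E := E) g w = w)
    (v : GroupLieAlgebra 𝓘(ℝ, E) N) : ⁅v, w⁆ = 0 := by
  obtain ⟨L, hL, hLw⟩ := hasMFDerivAt_groupAd_one w
  have e : (fun g : N ↦ groupAd (E := E) g w) = fun _ ↦ w := funext hw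
  rw [e] at hL
  rw [← hLw v]
  have h2 : L = 0 := hL.mfderiv.symm.trans mfderiv_const
  rw [h2]
  rfl

theorem mem_lieCenter_iff_groupAd [FiniteDimensional ℝ E] [PreconnectedSpace N]
    {w : GroupLieAlgebra 𝓘(ℝ, E) N} :
    w ∈ lieCenter E N ↔ ∀ g : N, groupAd (E := E) g w = w := by
  have : CompleteSpace E := FiniteDimensional.complete ℝ E
  rw [mem_lieCenter]
  exact ⟨groupAd_apply_eq_of_forall_lie_eq_zero, lie_eq_zero_of_forall_groupAd_apply_eq⟩

/-- The commutator map `x ↦ n x n⁻¹ x⁻¹` takes central values, so conjugations do not change it, and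
its derivative `Ad n - 1` takes values fixed by the adjoint action. -/
theorem groupAd_sub_mem_lieCenter [FiniteDimensional ℝ E] [PreconnectedSpace N] {n : N}
    (hn : ∀ x : N, n * x * n⁻¹ * x⁻¹ ∈ Subgroup.center N) (v : GroupLieAlgebra 𝓘(ℝ, E) N) :
    (show GroupLieAlgebra 𝓘(ℝ, E) N from (groupAd (E := E) n - ContinuousLinearMap.id ℝ E) v)
      ∈ lieCenter E N := by
  rw [mem_lieCenter_iff_groupAd]
  intro g
  have h0 := hasMFDerivAt_commutator_one (E := E) n
  have h1 := HasMFDerivAt.comp (I' := 𝓘(ℝ, E)) 1 (HasMFDerivAt.congr_point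
    (hasMFDerivAt_conj_one (E := E) g) (show 1 = n * 1 * n⁻¹ * 1⁻¹ by simp)) h0
  have e : (fun x : N ↦ g * x * g⁻¹) ∘ (fun x ↦ n * x * n⁻¹ * x⁻¹) =
      fun x ↦ n * x * n⁻¹ * x⁻¹ := by
    ext x
    simp only [Function.comp_apply]
    rw [Subgroup.mem_center_iff.1 (hn x) g, mul_inv_cancel_right]
  rw [e] at h1
  have h2 : groupAd (E := E) g ∘L (groupAd (E := E) n - ContinuousLinearMap.id ℝ E)
      = groupAd (E := E) n - ContinuousLinearMap.id ℝ E := h1.mfderiv.symm.trans h0.mfderiv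
  exact congrArg (fun A : E →L[ℝ] E ↦ A v) h2
end

section

/-! ### Groups of nilpotency class two -/

theorem Group.commutator_mem_center_of_nilpotencyClass_le_two {G : Type*} [Group G]
    [Group.IsNilpotent G] (h : Group.nilpotencyClass G ≤ 2) (n x : G) :
    n * x * n⁻¹ * x⁻¹ ∈ Subgroup.center G := by
  have h2 := Subgroup.upperCentralSeries_eq_top_iff_nilpotencyClass_le.2 h
  have h3 : n ∈ Subgroup.upperCentralSeries G (1 + 1) := by rw [h2]; trivial
  rw [Subgroup.mem_upperCentralSeries_succ_iff, Subgroup.upperCentralSeries_one] at h3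
  exact h3 x

theorem Group.exists_notMem_center_of_one_lt_nilpotencyClass {G : Type*} [Group G]
    [Group.IsNilpotent G] (h : 1 < Group.nilpotencyClass G) : ∃ n : G, n ∉ Subgroup.center G := by
  by_contra! hc
  have h1 : Subgroup.upperCentralSeries G 1 = ⊤ := by
    rw [Subgroup.upperCentralSeries_one, eq_top_iff]
    exact fun x _ ↦ hc x
  exact absurd (Subgroup.upperCentralSeries_eq_top_iff_nilpotencyClass_le.1 h1) (by omega)

variable {E : Type*} [NormedAddCommGroup E] [NormedSpace ℝ E]
  {N : Type*} [TopologicalSpace N] [ChartedSpace E N] [Group N]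

/-! ### Isometries of a bi-invariant metric -/

namespace PseudoRiemannianMetric

theorem mem_leftTranslate_of_eq_one {V : Submodule ℝ (GroupLieAlgebra 𝓘(ℝ, E) N)} {y : N}
    (hy : y = 1) (u : E) :
    (show TangentSpace 𝓘(ℝ, E) y from u) ∈ leftTranslate V y ↔
      (show GroupLieAlgebra 𝓘(ℝ, E) N from u) ∈ V := by
  subst hy
  have d : HasMFDerivAt 𝓘(ℝ, E) 𝓘(ℝ, E) (fun z : N ↦ 1 * z) 1 (ContinuousLinearMap.id ℝ E) := by
    have e : (fun z : N ↦ 1 * z) = id := by ext; simp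
    rw [e]
    exact hasMFDerivAt_id _
  have d' (w : E) : (mfderiv 𝓘(ℝ, E) 𝓘(ℝ, E) (fun z : N ↦ 1 * z) 1 : E →L[ℝ] E) w = w :=
    congrArg (fun A : E →L[ℝ] E ↦ A w) d.mfderiv
  constructor
  · rintro ⟨w, hw, hwu⟩
    have h2 : w = u := (d' w).symm.trans hwu
    exact h2 ▸ hw
  · intro hu
    exact ⟨u, hu, d' u⟩

theorem groupAd_mem_of_preservesDistribution {V : Submodule ℝ (GroupLieAlgebra 𝓘(ℝ, E) N)} {n : N}
    (h : PreservesDistribution (MulAut.conj n).toEquiv (leftTranslate V)) {v : E}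
    (hv : (show GroupLieAlgebra 𝓘(ℝ, E) N from v) ∈ V) :
    (show GroupLieAlgebra 𝓘(ℝ, E) N from groupAd (E := E) n v) ∈ V := by
  have e : (MulAut.conj n).toEquiv (1 : N) = 1 := map_one (MulAut.conj n)
  rw [← mem_leftTranslate_of_eq_one e, ← h 1]
  exact ⟨v, (mem_leftTranslate_of_eq_one rfl v).2 hv, rfl⟩

variable [LieGroup 𝓘(ℝ, E) ∞ N]

theorem IsPreservedBy.inner_eq {m : PseudoRiemannianMetric E N} {f : N → N}
    (hf : m.IsPreservedBy f) {x y : N} (hxy : f x = y) {L : E →L[ℝ] E}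
    (hL : HasMFDerivAt 𝓘(ℝ, E) 𝓘(ℝ, E) f x L) (u v : E) :
    m.inner y (L u) (L v) = m.inner x u v := by
  subst hxy
  have h := hf x u v
  rw [hL.mfderiv] at h
  exact h

theorem IsBiInvariant.mulLeft_mem_iso {m : PseudoRiemannianMetric E N} (hm : m.IsBiInvariant)
    (a : N) : Equiv.mulLeft a ∈ m.Iso := by
  refine ⟨contMDiff_mul_left, ?_, hm.1 a⟩
  have e : ((Equiv.mulLeft a).symm : N → N) = fun x ↦ a⁻¹ * x := by ext; simp
  rw [e]
  exact contMDiff_mul_left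

theorem IsBiInvariant.mulRight_mem_iso {m : PseudoRiemannianMetric E N} (hm : m.IsBiInvariant)
    (a : N) : Equiv.mulRight a ∈ m.Iso := by
  refine ⟨contMDiff_mul_right, ?_, hm.2 a⟩
  have e : ((Equiv.mulRight a).symm : N → N) = fun x ↦ x * a⁻¹ := by ext; simp
  rw [e]
  exact contMDiff_mul_right

theorem IsBiInvariant.conj_mem_iso {m : PseudoRiemannianMetric E N} (hm : m.IsBiInvariant)
    (n : N) : (MulAut.conj n).toEquiv ∈ m.Iso := by
  have e : (MulAut.conj n).toEquiv = Equiv.mulRight n⁻¹ * Equiv.mulLeft n := by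
    ext x
    simp
  rw [e]
  exact m.Iso.mul_mem (hm.mulRight_mem_iso _) (hm.mulLeft_mem_iso _)

theorem IsBiInvariant.conj_mem_isoAut {m : PseudoRiemannianMetric E N} (hm : m.IsBiInvariant)
    (n : N) : (MulAut.conj n).toEquiv ∈ m.IsoAut :=
  ⟨1, MulAut.conj n, hm.conj_mem_iso n, by ext; simp⟩

theorem IsBiInvariant.isoAut_le_iso {m : PseudoRiemannianMetric E N} (hm : m.IsBiInvariant) :
    m.IsoAut ≤ m.Iso := by
  rintro _ ⟨a, φ, hφ, rfl⟩
  exact m.Iso.mul_mem (hm.mulLeft_mem_iso a) hφ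

theorem IsBiInvariant.inner_groupAd {m : PseudoRiemannianMetric E N} (hm : m.IsBiInvariant)
    (n : N) (u v : E) :
    m.inner 1 (groupAd (E := E) n u) (groupAd (E := E) n v) = m.inner 1 u v :=
  (hm.conj_mem_iso n).2.2.inner_eq (show n * 1 * n⁻¹ = 1 by simp) (hasMFDerivAt_conj_one n) u v

theorem IsBiInvariant.inv_mem_iso {m : PseudoRiemannianMetric E N} (hm : m.IsBiInvariant) :
    Equiv.inv N ∈ m.Iso := by
  refine ⟨contMDiff_inv 𝓘(ℝ, E) ∞, contMDiff_inv 𝓘(ℝ, E) ∞, fun x u v ↦ ?_⟩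
  obtain ⟨A, hA⟩ : ∃ A : E →L[ℝ] E,
      HasMFDerivAt 𝓘(ℝ, E) 𝓘(ℝ, E) (fun y : N ↦ x⁻¹ * y) x A := ⟨_, hasMFDerivAt_mul_left _ _⟩
  obtain ⟨B, hB⟩ : ∃ B : E →L[ℝ] E,
      HasMFDerivAt 𝓘(ℝ, E) 𝓘(ℝ, E) (fun y : N ↦ y * x⁻¹) 1 B := ⟨_, hasMFDerivAt_mul_right _ _⟩
  have h1 := HasMFDerivAt.comp (I' := 𝓘(ℝ, E)) x (HasMFDerivAt.congr_point
    (hasMFDerivAt_inv_one (E := E)) (inv_mul_cancel x).symm) hA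
  have h2 := HasMFDerivAt.comp (I' := 𝓘(ℝ, E)) x (HasMFDerivAt.congr_point hB
    (show 1 = (x⁻¹ * x)⁻¹ by simp)) h1
  have e : (fun y : N ↦ y * x⁻¹) ∘ (fun x : N ↦ x⁻¹) ∘ (fun y ↦ x⁻¹ * y) = Equiv.inv N := by
    ext y
    simp
  -- So the derivative of the inversion at `x` is `-(B ∘ A)`, with `A`, `B` translating `x` to `1`
  -- and `1` to `x⁻¹`.
  rw [e] at h2
  have h3 : HasMFDerivAt 𝓘(ℝ, E) 𝓘(ℝ, E) (Equiv.inv N) x (-(B ∘L A)) := by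
    refine HasMFDerivAt.congr_mfderiv h2 (ContinuousLinearMap.ext fun w ↦ ?_)
    exact map_neg B (A w)
  have hl := (hm.1 x⁻¹).inner_eq (inv_mul_cancel x) hA u v
  have hr := (hm.2 x⁻¹).inner_eq (one_mul x⁻¹) hB (A u) (A v)
  rw [h3.mfderiv]
  have hneg (b : E →L[ℝ] E →L[ℝ] ℝ) (p q : E) : b (-p) (-q) = b p q := by simp
  exact (hneg (m.inner x⁻¹) (B (A u)) (B (A v))).trans (hr.trans hl)

theorem inv_notMem_isoAut (m : PseudoRiemannianMetric E N) {n : N}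
    (hn : n ∉ Subgroup.center N) : Equiv.inv N ∉ m.IsoAut := by
  rintro ⟨a, φ, -, h⟩
  have h' (x : N) : x⁻¹ = a * φ x := congrArg (fun f : Equiv.Perm N ↦ f x) h
  have ha : a = 1 := by simpa using (h' 1).symm
  simp only [ha, one_mul] at h'
  refine hn (Subgroup.mem_center_iff.2 fun g ↦ ?_)
  have h1 := h' (n * g)
  rw [map_mul, ← h', ← h', ← mul_inv_rev, inv_inj] at h1
  exact h1.symm

variable [FiniteDimensional ℝ E] [PreconnectedSpace N]

theorem conj_notMem_isoSpl (m : PseudoRiemannianMetric E N)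
    {V : Submodule ℝ (GroupLieAlgebra 𝓘(ℝ, E) N)} (hV : IsCompl V (lieCenter E N)) {n : N}
    (hcomm : ∀ x : N, n * x * n⁻¹ * x⁻¹ ∈ Subgroup.center N)
    (hn : n ∉ Subgroup.center N) : (MulAut.conj n).toEquiv ∉ m.IsoSpl V := by
  -- Preserving `V` alone is contradictory: it forces `Ad n = 1`.
  rintro ⟨-, hpV, -⟩
  refine hn (mem_center_of_groupAd_eq_id (E := E) (ContinuousLinearMap.ext fun w ↦ ?_))
  obtain ⟨v, hv, z, hz, hvz⟩ := Submodule.mem_sup.1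
    (show (show GroupLieAlgebra 𝓘(ℝ, E) N from w) ∈ V ⊔ lieCenter E N by
      rw [hV.sup_eq_top]; trivial)
  have h1 := V.sub_mem (groupAd_mem_of_preservesDistribution hpV hv) hv
  have h3 := (Submodule.disjoint_def.1 hV.disjoint) _ h1 (groupAd_sub_mem_lieCenter hcomm v)
  have h4 : groupAd (E := E) n v = v := sub_eq_zero.1 h3
  have h5 := mem_lieCenter_iff_groupAd.1 hz n
  have h6 : (groupAd (E := E) n) w = groupAd (E := E) n v + groupAd (E := E) n z :=
    (congrArg (groupAd (E := E) n) hvz.symm).trans (map_add (groupAd (E := E) n) v z)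
  rw [h4, h5] at h6
  exact h6.trans hvz

theorem IsBiInvariant.centerIsDegenerate {m : PseudoRiemannianMetric E N} (hm : m.IsBiInvariant)
    {n : N} (hcomm : ∀ x : N, n * x * n⁻¹ * x⁻¹ ∈ Subgroup.center N)
    (hn : n ∉ Subgroup.center N) : m.CenterIsDegenerate := by
  have h : ∃ v : E, groupAd (E := E) n v ≠ v := by
    by_contra! h
    exact hn (mem_center_of_groupAd_eq_id (E := E) (ContinuousLinearMap.ext h))
  obtain ⟨v, hv⟩ := h
  refine ⟨(groupAd (E := E) n - ContinuousLinearMap.id ℝ E) v,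
    groupAd_sub_mem_lieCenter hcomm v, fun h0 ↦ hv (sub_eq_zero.1 h0), fun w hw ↦ ?_⟩
  have h1 := hm.inner_groupAd n v w
  rw [mem_lieCenter_iff_groupAd.1 hw n] at h1
  have hsub (b : E →L[ℝ] E →L[ℝ] ℝ) (p q r : E) (h : b p r = b q r) : b (p - q) r = 0 := by
    simp [h]
  exact hsub (m.inner 1) _ _ _ h1

end PseudoRiemannianMetric
end

end

open PseudoRiemannianMetric in
theorem mainTheorem5 {E : Type*} [NormedAddCommGroup E] [NormedSpace ℝ E] [FiniteDimensional ℝ E]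
    {N : Type*} [TopologicalSpace N] [ChartedSpace E N] [Group N] [LieGroup 𝓘(ℝ, E) ∞ N]
    [ConnectedSpace N] (hN : Group.nilpotencyClass N = 2)
    (m : PseudoRiemannianMetric E N) (hm : m.IsBiInvariant) :
    m.CenterIsDegenerate ∧
    (∀ V : Submodule ℝ (GroupLieAlgebra 𝓘(ℝ, E) N), IsCompl V (lieCenter E N) →
      m.IsoSpl V ≠ m.IsoAut ∧ m.IsoSpl V < m.Iso ∧
      ∀ n : N, n ∉ Subgroup.center N → (MulAut.conj n).toEquiv ∉ m.IsoSpl V) ∧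
    m.IsoAut < m.Iso ∧
    (∀ n : N, (MulAut.conj n).toEquiv ∈ m.IsoAut) ∧
    Equiv.inv N ∈ m.Iso ∧ Equiv.inv N ∉ m.IsoAut := by
  -- The nilpotency class of a group that is not nilpotent is the junk value `0`.
  have : Group.IsNilpotent N := by
    by_contra h
    rw [Group.nilpotencyClass_of_not_nilpotent h] at hN
    exact absurd hN (by norm_num)
  have hcomm := Group.commutator_mem_center_of_nilpotencyClass_le_two hN.le
  obtain ⟨n, hn⟩ := Group.exists_notMem_center_of_one_lt_nilpotencyClass (G := N) (by omega)
  have hinv := m.inv_notMem_isoAut hn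
  refine ⟨hm.centerIsDegenerate (hcomm n) hn, fun V hV ↦ ?_,
    lt_of_le_of_ne hm.isoAut_le_iso fun h ↦ hinv (h ▸ hm.inv_mem_iso),
    hm.conj_mem_isoAut, hm.inv_mem_iso, hinv⟩
  have hspl (k : N) (hk : k ∉ Subgroup.center N) : (MulAut.conj k).toEquiv ∉ m.IsoSpl V :=
    m.conj_notMem_isoSpl hV (hcomm k) hk
  exact ⟨fun h ↦ hspl n hn (h ▸ hm.conj_mem_isoAut n),
    lt_of_le_of_ne (fun f hf ↦ hf.1) fun h ↦ hspl n hn (h ▸ hm.conj_mem_iso n), hspl⟩
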